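/- Write $D(0,r)=\{z\in\mathbb{C}:|z|<r\}$ and let $|E|$ denote the planar Lebesgue measure of a measurable set $E\subset\mathbb{C}$. There exist absolute constants $c>0$ and $c''>0$ such that the following holds. For all $0<r<\rho$ there is a constant $\eta>0$ (depending only on $r$ and $\rho$) with \[ \eta\le c''\,\frac{\rho^4}{(\rho-r)^4}\Bigl(1+\ln\frac{\rho}{\rho-r}\Bigr), \] and, if $r\ge\rho/2$, even with \[ \eta\le c''\,\frac{\rho^4}{(\rho-r)^4}\,\ln\frac{\rho}{\rho-r}, \] such that: if $\phi$ is analytic in $D(0,\rho)$, $E\subset D(0,r)$ is a Lebesgue measurable set with $|E|>0$, $z_0\in D(0,r)$ is a point with $|\phi(z_0)|\ge 1$, and $M$ is a real number with $|\phi(z)|\le M$ for all $z\in D(0,\rho)$ (in particular, if $M=\max_{|z|\le\rho}|\phi(z)|$ or $M=\sup_{|z|<\rho}|\phi(z)|<\infty$), then for every $p\in[1,+\infty)$ \[ \|\phi\|_{L^p(D(0,r))}\le\left(\frac{c\,r^2}{|E|}\right)^{\eta\ln M+\frac1p}\|\phi\|_{L^p(E)}, \] where the $L^p$ norms are taken with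 respect to planar Lebesgue measure. -/

import Mathlib

open MeasureTheory Metric Complex InnerProductSpace

open scoped ComplexConjugate

/-! Rescale to the unit disc and divide by `M`, so that `‖f‖ ≤ 1`. The core
(`integral_log_norm_unitDisc`) bounds `-log ‖f‖` on average over `E` by `K Λ · (-log ‖f z₀‖)`, with
`K = 16 / (1 - r) ^ 2` and `Λ = log (32 π r² / |E|)`. Both sides are additive under products, so it
suffices to treat the factors of `f`. A Blaschke factor costs at most `Λ` on average over `E`,
because its logarithmic singularity is integrable, while at `z₀` its `-log` is at least `1 / K`. A
factor without zeros on a slightly larger disc has a nonnegative harmonic `-log`, and Harnack's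
inequality compares its values on `E` with that at `z₀`. Jensen's inequality turns the bound on the
mean of `log ‖φ‖` into a lower bound for the `Lᵖ` norm on `E`; the norm on the whole disc is bounded
trivially through `M`. This gives an `η` quadratic in `R / (R - r)`, better than the quartic bound
required. -/

/-! ### Blaschke factors and pointwise bounds for the Green function -/

/-- `‖1 - ā z‖² - ‖z - a‖² = (1 - ‖a‖²) (1 - ‖z‖²)`. -/
theorem norm_one_sub_conj_mul_sq (a z : ℂ) :
    ‖1 - conj a * z‖ ^ 2 = ‖z - a‖ ^ 2 + (1 - ‖a‖ ^ 2) * (1 - ‖z‖ ^ 2) := by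
  simp only [← Complex.normSq_eq_norm_sq, Complex.normSq_apply]
  simp
  ring

theorem one_sub_conj_mul_ne_zero {a z : ℂ} (ha : ‖a‖ < 1) (hz : ‖z‖ < 1) :
    1 - conj a * z ≠ 0 := by
  intro h
  have h2 := norm_one_sub_conj_mul_sq a z
  rw [h, norm_zero] at h2
  have : 0 < (1 - ‖a‖ ^ 2) * (1 - ‖z‖ ^ 2) := by
    apply mul_pos <;> nlinarith [norm_nonneg a, norm_nonneg z]
  nlinarith [sq_nonneg ‖z - a‖]

/-- The Blaschke factor of the unit disc that vanishes at `a`. -/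
noncomputable def blaschkeFactor (a z : ℂ) : ℂ := (z - a) / (1 - conj a * z)

theorem blaschkeFactor_ne_zero {a z : ℂ} (ha : ‖a‖ < 1) (hz : ‖z‖ < 1) (h : z ≠ a) :
    blaschkeFactor a z ≠ 0 :=
  div_ne_zero (sub_ne_zero.2 h) (one_sub_conj_mul_ne_zero ha hz)

theorem norm_blaschkeFactor_sq {a z : ℂ} (ha : ‖a‖ < 1) (hz : ‖z‖ < 1) :
    ‖blaschkeFactor a z‖ ^ 2 = 1 - (1 - ‖a‖ ^ 2) * (1 - ‖z‖ ^ 2) / ‖1 - conj a * z‖ ^ 2 := by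
  have h : ‖1 - conj a * z‖ ≠ 0 := norm_ne_zero_iff.2 (one_sub_conj_mul_ne_zero ha hz)
  rw [blaschkeFactor, norm_div, div_pow, eq_sub_iff_add_eq, ← add_div,
    ← norm_one_sub_conj_mul_sq a z, div_self (pow_ne_zero 2 h)]

theorem norm_blaschkeFactor_lt_one {a z : ℂ} (ha : ‖a‖ < 1) (hz : ‖z‖ < 1) :
    ‖blaschkeFactor a z‖ < 1 := by
  have h : 0 < ‖1 - conj a * z‖ := norm_pos_iff.2 (one_sub_conj_mul_ne_zero ha hz)
  have h1 : 0 < 1 - ‖a‖ ^ 2 := by nlinarith [norm_nonneg a]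
  have h2 : 0 < 1 - ‖z‖ ^ 2 := by nlinarith [norm_nonneg z]
  have h3 : 0 < (1 - ‖a‖ ^ 2) * (1 - ‖z‖ ^ 2) / ‖1 - conj a * z‖ ^ 2 := by positivity
  have h4 := norm_blaschkeFactor_sq ha hz
  nlinarith [norm_nonneg (blaschkeFactor a z)]

theorem norm_one_sub_conj_mul_le_two {a z : ℂ} (ha : ‖a‖ < 1) (hz : ‖z‖ < 1) :
    ‖1 - conj a * z‖ ≤ 2 := by
  have h1 : ‖conj a * z‖ ≤ 1 := by
    rw [norm_mul, RCLike.norm_conj]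
    nlinarith [norm_nonneg a, norm_nonneg z]
  calc ‖1 - conj a * z‖ ≤ ‖(1 : ℂ)‖ + ‖conj a * z‖ := norm_sub_le _ _
    _ ≤ 2 := by rw [norm_one]; linarith

/-- Quantitative lower bound for the Green function of the unit disc. -/
theorem le_neg_log_norm_blaschkeFactor {a z : ℂ} (ha : ‖a‖ < 1) (hz : ‖z‖ < 1) (hza : z ≠ a) :
    (1 - ‖a‖) * (1 - ‖z‖) / 8 ≤ -Real.log ‖blaschkeFactor a z‖ := by
  have h : 0 < ‖1 - conj a * z‖ := norm_pos_iff.2 (one_sub_conj_mul_ne_zero ha hz)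
  have hb : 0 < ‖blaschkeFactor a z‖ := norm_pos_iff.2 (blaschkeFactor_ne_zero ha hz hza)
  have h2 := norm_one_sub_conj_mul_le_two ha hz
  have h3 : (1 - ‖a‖) * (1 - ‖z‖) / 4
      ≤ (1 - ‖a‖ ^ 2) * (1 - ‖z‖ ^ 2) / ‖1 - conj a * z‖ ^ 2 := by
    have := norm_nonneg a
    have := norm_nonneg z
    apply div_le_div₀
    · apply mul_nonneg <;> nlinarith
    · apply mul_le_mul <;> nlinarith
    · positivity
    · nlinarith
  have h4 := norm_blaschkeFactor_sq ha hz
  have h5 := Real.log_le_sub_one_of_pos (show 0 < ‖blaschkeFactor a z‖ ^ 2 by positivity)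
  rw [Real.log_pow] at h5
  push_cast at h5
  linarith

/-- This is `log x ≤ x - 1` at `x = ‖1 - ā z‖ / (k ‖z - a‖)`. The parameter `k` stays free so that
it can be matched to the measure of `E` after integration. -/
theorem neg_log_norm_blaschkeFactor_le {a z : ℂ} (ha : ‖a‖ < 1) (hz : ‖z‖ < 1) (hza : z ≠ a)
    {k : ℝ} (hk : 0 < k) :
    -Real.log ‖blaschkeFactor a z‖ ≤ 2 / k * ‖z - a‖⁻¹ + (Real.log k - 1) := by
  have h : 0 < ‖1 - conj a * z‖ := norm_pos_iff.2 (one_sub_conj_mul_ne_zero ha hz)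
  have h0 : 0 < ‖z - a‖ := norm_pos_iff.2 (sub_ne_zero.2 hza)
  have h2 := norm_one_sub_conj_mul_le_two ha hz
  have h5 := Real.log_le_sub_one_of_pos
    (show 0 < ‖1 - conj a * z‖ / ‖z - a‖ / k by positivity)
  rw [Real.log_div (by positivity) hk.ne'] at h5
  have h6 : ‖1 - conj a * z‖ / ‖z - a‖ / k ≤ 2 / k * ‖z - a‖⁻¹ := by
    rw [div_div, mul_comm ‖z - a‖ k, ← div_div, div_eq_mul_inv (_ / k)]
    gcongr
  rw [blaschkeFactor, norm_div, ← Real.log_inv, inv_div]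
  linarith

/-- **Schwarz–Pick lemma**, as a division by a Blaschke factor. -/
theorem exists_eq_blaschkeFactor_mul {f : ℂ → ℂ} (hf : DifferentiableOn ℂ f (ball 0 1))
    (hb : ∀ z ∈ ball (0 : ℂ) 1, ‖f z‖ ≤ 1) {a : ℂ} (ha : ‖a‖ < 1) (hfa : f a = 0) :
    ∃ g : ℂ → ℂ, DifferentiableOn ℂ g (ball 0 1) ∧ (∀ z ∈ ball (0 : ℂ) 1, ‖g z‖ ≤ 1) ∧
      ∀ z ∈ ball (0 : ℂ) 1, f z = blaschkeFactor a z * g z := by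
  have haB : a ∈ ball (0 : ℂ) 1 := by simpa using ha
  set g : ℂ → ℂ := fun z => dslope f a z * (1 - conj a * z) with hg
  have hgd : DifferentiableOn ℂ g (ball 0 1) := by
    apply DifferentiableOn.mul
    · exact (Complex.differentiableOn_dslope (isOpen_ball.mem_nhds haB)).2 hf
    · fun_prop
  have hfg : ∀ z ∈ ball (0 : ℂ) 1, f z = blaschkeFactor a z * g z := by
    intro z hz
    have hne := one_sub_conj_mul_ne_zero ha (mem_ball_zero_iff.1 hz)
    have h1 := sub_smul_dslope f a z
    rw [hfa, sub_zero, smul_eq_mul] at h1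
    rw [hg, blaschkeFactor, ← h1, div_mul_eq_mul_div, eq_div_iff hne, mul_assoc]
  have hle : ∀ z ∈ ball (0 : ℂ) 1, z ≠ a → ‖g z‖ ≤ 1 := by
    intro z hz hza
    have hz1 := mem_ball_zero_iff.1 hz
    have hca : ‖-a‖ < 1 := by simpa using ha
    have hmaps : Set.MapsTo (blaschkeFactor (-a)) (ball 0 1) (ball 0 1) := fun w hw =>
      mem_ball_zero_iff.2 (norm_blaschkeFactor_lt_one hca (mem_ball_zero_iff.1 hw))
    have hmd : DifferentiableOn ℂ (blaschkeFactor (-a)) (ball 0 1) := by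
      unfold blaschkeFactor
      apply DifferentiableOn.div
      · fun_prop
      · fun_prop
      · intro w hw
        exact one_sub_conj_mul_ne_zero hca (mem_ball_zero_iff.1 hw)
    have hw := norm_blaschkeFactor_lt_one ha hz1
    -- Schwarz's lemma for `f` composed with the inverse of the Blaschke factor at `a`, which is the
    -- factor at `-a`.
    have key := Complex.norm_le_norm_of_mapsTo_ball (hf.comp hmd hmaps)
      (fun w hw => mem_closedBall_zero_iff.2 (hb _ (hmaps hw)))
      (by simp [blaschkeFactor, hfa]) hw
    have hinv : blaschkeFactor (-a) (blaschkeFactor a z) = z := by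
      have hne := one_sub_conj_mul_ne_zero ha hz1
      have hne' := one_sub_conj_mul_ne_zero hca hw
      have hb : blaschkeFactor a z * (1 - conj a * z) = z - a := div_mul_cancel₀ _ hne
      rw [blaschkeFactor, div_eq_iff hne', map_neg]
      linear_combination hb
    have hpos : 0 < ‖blaschkeFactor a z‖ := norm_pos_iff.2 (blaschkeFactor_ne_zero ha hz1 hza)
    rw [Function.comp_apply, hinv, hfg z hz, norm_mul] at key
    exact le_of_mul_le_mul_left (by simpa using key) hpos
  refine ⟨g, hgd, fun z hz => ?_, hfg⟩
  rcases eq_or_ne z a with rfl | hza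
  -- The bound at the zero itself follows by continuity from the punctured neighbourhood.
  · have hc : ContinuousAt g z := (hgd.differentiableAt (isOpen_ball.mem_nhds hz)).continuousAt
    refine le_of_tendsto (hc.norm.tendsto.mono_left (nhdsWithin_le_nhds (s := {z}ᶜ))) ?_
    filter_upwards [self_mem_nhdsWithin, nhdsWithin_le_nhds (isOpen_ball.mem_nhds hz)] with w h1 h2
    exact hle w h2 h1
  · exact hle z hz hza

/-! ### Harnack's inequality from the Poisson kernel -/

/-- **Harnack's inequality** comparing a nonnegative harmonic function with its value at the
center. -/
theorem InnerProductSpace.HarmonicOnNhd.harnack_center {u : ℂ → ℝ} {R : ℝ} {w : ℂ}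
    (hu : HarmonicOnNhd u (closedBall 0 R)) (h0 : ∀ z ∈ closedBall (0 : ℂ) R, 0 ≤ u z)
    (hw : w ∈ ball (0 : ℂ) R) :
    u w ≤ (R + ‖w‖) / (R - ‖w‖) * u 0 ∧ (R - ‖w‖) / (R + ‖w‖) * u 0 ≤ u w := by
  have hR : 0 < R := pos_of_mem_ball hw
  have hP := hu.circleAverage_re_herglotzRieszKernel_smul hw
  have hC : Real.circleAverage u 0 R = u 0 :=
    HarmonicOnNhd.circleAverage_eq (by rwa [abs_of_pos hR])
  have hcu : ContinuousOn u (sphere 0 R) := fun z hz =>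
    (hu z (sphere_subset_closedBall hz)).1.continuousAt.continuousWithinAt
  have hI : ∀ k : ℝ, CircleIntegrable (k • u) 0 R := fun k =>
    (continuousOn_const.smul hcu).circleIntegrable hR.le
  have hK : ContinuousOn (herglotzRieszKernel 0 w) (sphere 0 R) := by
    simpa only [abs_of_pos hR] using continuousOn_herglotzRieszKernel_sphere hw
  have hIP : CircleIntegrable ((Complex.re ∘ herglotzRieszKernel 0 w) • u) 0 R :=
    ((Complex.continuous_re.comp_continuousOn hK).smul hcu).circleIntegrable hR.le
  constructor
  · rw [← hP, ← hC, ← smul_eq_mul, ← Real.circleAverage_smul]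
    refine Real.circleAverage_mono hIP (hI _) fun z hz => ?_
    rw [abs_of_pos hR] at hz
    have := re_herglotzRieszKernel_le hz hw
    simp only [sub_zero] at this
    simpa [herglotzRieszKernel_def] using
      mul_le_mul_of_nonneg_right this (h0 z (sphere_subset_closedBall hz))
  · rw [← hP, ← hC, ← smul_eq_mul, ← Real.circleAverage_smul]
    refine Real.circleAverage_mono (hI _) hIP fun z hz => ?_
    rw [abs_of_pos hR] at hz
    have := le_re_herglotzRieszKernel hz hw
    simp only [sub_zero] at this
    simpa [herglotzRieszKernel_def] using
      mul_le_mul_of_nonneg_right this (h0 z (sphere_subset_closedBall hz))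

/-- **Harnack's inequality** for two points of a concentric smaller disc. -/
theorem InnerProductSpace.HarmonicOnNhd.harnack {u : ℂ → ℝ} {R r : ℝ} {z w : ℂ} (hrR : r < R)
    (hu : HarmonicOnNhd u (closedBall 0 R)) (h0 : ∀ z ∈ closedBall (0 : ℂ) R, 0 ≤ u z)
    (hz : z ∈ ball (0 : ℂ) r) (hw : w ∈ ball (0 : ℂ) r) :
    u z ≤ ((R + r) / (R - r)) ^ 2 * u w := by
  have hr : 0 < r := pos_of_mem_ball hz
  have hz1 := (hu.harnack_center h0 (ball_subset_ball hrR.le hz)).1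
  have hw1 := (hu.harnack_center h0 (ball_subset_ball hrR.le hw)).2
  rw [mem_ball_zero_iff] at hz hw
  have h00 : 0 ≤ u 0 := h0 0 (by simp; linarith)
  have hR' : 0 < R - r := by linarith
  have hR : 0 < R := by linarith
  have hz2 : u z ≤ (R + r) / (R - r) * u 0 := by
    refine hz1.trans (mul_le_mul_of_nonneg_right ?_ h00)
    gcongr
  have hw2 : (R - r) / (R + r) * u 0 ≤ u w := by
    refine le_trans (mul_le_mul_of_nonneg_right ?_ h00) hw1
    have := norm_nonneg w
    gcongr
    linarith
  calc u z ≤ (R + r) / (R - r) * u 0 := hz2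
    _ = ((R + r) / (R - r)) ^ 2 * ((R - r) / (R + r) * u 0) := by
      field_simp
    _ ≤ _ := by gcongr

/-! ### Integrals of the Green function over a set -/

-- In polar coordinates the Jacobian cancels the singularity.
open scoped ENNReal in
theorem lintegral_inv_norm_ball (R : ℝ) :
    ∫⁻ z in ball (0 : ℂ) R, ‖z‖ₑ⁻¹ ≤ ENNReal.ofReal (2 * Real.pi * R) := by
  rw [← lintegral_indicator measurableSet_ball, ← Complex.lintegral_comp_polarCoord_symm]
  calc _ ≤ ∫⁻ p in polarCoord.target, (Set.Ioo (0:ℝ) R ×ˢ Set.Ioo (-Real.pi) Real.pi).indicator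
        (fun _ => (1 : ℝ≥0∞)) p := by
        refine setLIntegral_mono' polarCoord.open_target.measurableSet fun p hp => ?_
        obtain ⟨h1, h2⟩ := hp
        have h1' : 0 < p.1 := h1
        have hn : ‖Complex.polarCoord.symm p‖ = p.1 := by
          rw [Complex.norm_polarCoord_symm, abs_of_pos h1']
        by_cases hpR : p.1 < R
        · rw [Set.indicator_of_mem (by simpa only [mem_ball_zero_iff, hn] using hpR),
            Set.indicator_of_mem (by exact ⟨⟨h1', hpR⟩, h2⟩), ← ofReal_norm, hn, smul_eq_mul,
            ENNReal.mul_inv_cancel (by simpa using h1') ENNReal.ofReal_ne_top]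
        · rw [Set.indicator_of_notMem (by simpa only [mem_ball_zero_iff, hn] using hpR), smul_zero]
          exact zero_le
    _ ≤ ∫⁻ p, (Set.Ioo (0:ℝ) R ×ˢ Set.Ioo (-Real.pi) Real.pi).indicator
        (fun _ => (1 : ℝ≥0∞)) p := lintegral_mono' Measure.restrict_le_self le_rfl
    _ = ENNReal.ofReal (2 * Real.pi * R) := by
        rw [lintegral_indicator (measurableSet_Ioo.prod measurableSet_Ioo), setLIntegral_const,
          one_mul, Measure.volume_eq_prod, Measure.prod_prod, Real.volume_Ioo, Real.volume_Ioo,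
          mul_comm, ← ENNReal.ofReal_mul (by linarith [Real.pi_pos])]
        congr 1
        ring

theorem lintegral_inv_norm_sub_le {a : ℂ} (ha : ‖a‖ < 1) {E : Set ℂ} (hE : E ⊆ ball 0 1) :
    ∫⁻ z in E, ‖z - a‖ₑ⁻¹ ≤ ENNReal.ofReal (4 * Real.pi) := by
  calc ∫⁻ z in E, ‖z - a‖ₑ⁻¹ ≤ ∫⁻ z in ball a 2, ‖z - a‖ₑ⁻¹ := by
        refine lintegral_mono_set fun z hz => ?_
        have := mem_ball_zero_iff.1 (hE hz)
        rw [mem_ball, dist_eq_norm]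
        linarith [norm_sub_le z a]
    _ = ∫⁻ z in ball (0 : ℂ) 2, ‖z‖ₑ⁻¹ := by
        rw [← (measurePreserving_sub_right volume a).setLIntegral_comp_preimage_emb
          (MeasurableEquiv.subRight a).measurableEmbedding (fun z => ‖z‖ₑ⁻¹) (ball 0 2)]
        congr 2
        ext z
        simp [dist_eq_norm]
    _ ≤ _ := (lintegral_inv_norm_ball 2).trans_eq (by ring_nf)

theorem integrableOn_inv_norm_sub {a : ℂ} (ha : ‖a‖ < 1) {E : Set ℂ} (hE : E ⊆ ball 0 1) :
    IntegrableOn (fun z => ‖z - a‖⁻¹) E ∧ ∫ z in E, ‖z - a‖⁻¹ ≤ 4 * Real.pi := by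
  have hm : Measurable fun z : ℂ => ‖z - a‖⁻¹ := by fun_prop
  have hae : ∀ᵐ z ∂(volume.restrict E), ENNReal.ofReal ‖z - a‖⁻¹ = ‖z - a‖ₑ⁻¹ := by
    refine ae_restrict_of_ae ?_
    filter_upwards [compl_mem_ae_iff.2 (measure_singleton a)] with z hz
    have : 0 < ‖z - a‖ := norm_pos_iff.2 (sub_ne_zero.2 hz)
    rw [ENNReal.ofReal_inv_of_pos this, ofReal_norm]
  have hl := lintegral_inv_norm_sub_le ha hE
  rw [← lintegral_congr_ae hae] at hl
  constructor
  · refine ⟨hm.aestronglyMeasurable, ?_⟩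
    rw [hasFiniteIntegral_iff_ofReal (Filter.Eventually.of_forall fun z => by positivity)]
    exact hl.trans_lt ENNReal.ofReal_lt_top
  · rw [integral_eq_lintegral_of_nonneg_ae (Filter.Eventually.of_forall fun z => by positivity)
      hm.aestronglyMeasurable]
    exact ENNReal.toReal_le_of_le_ofReal (by positivity) hl

theorem measureReal_le_of_subset_ball {E : Set ℂ} {r : ℝ} (hr : 0 < r) (hE : E ⊆ ball 0 r) :
    volume.real E ≤ Real.pi * r ^ 2 := by
  refine (measureReal_mono hE measure_ball_lt_top.ne).trans_eq ?_
  rw [measureReal_def, Complex.volume_ball, ENNReal.toReal_mul, ENNReal.toReal_pow,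
    ENNReal.toReal_ofReal hr.le, mul_comm]
  rfl

theorem volume_ne_top_of_subset_ball {E : Set ℂ} {r : ℝ} (hE : E ⊆ ball 0 r) :
    volume E ≠ ⊤ := ((measure_mono hE).trans_lt measure_ball_lt_top).ne

theorem measurable_blaschkeFactor (a : ℂ) : Measurable (blaschkeFactor a) := by
  unfold blaschkeFactor
  fun_prop

/-- Integral of the Green function of the unit disc over a set. -/
theorem integral_log_norm_blaschkeFactor {a : ℂ} (ha : ‖a‖ < 1) {E : Set ℂ}
    (hE : E ⊆ ball 0 1) (hEm : NullMeasurableSet E) (hEp : 0 < volume.real E) :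
    IntegrableOn (fun z => Real.log ‖blaschkeFactor a z‖) E ∧
      -∫ z in E, Real.log ‖blaschkeFactor a z‖
        ≤ volume.real E * Real.log (8 * Real.pi / volume.real E) := by
  have hpi := Real.pi_pos
  obtain ⟨hI, hle⟩ := integrableOn_inv_norm_sub ha hE
  have hfin := volume_ne_top_of_subset_ball hE
  have hae : ∀ᵐ z ∂(volume.restrict E), z ∈ E ∧ z ≠ a := by
    filter_upwards [ae_restrict_mem₀ hEm,
      ae_restrict_of_ae (compl_mem_ae_iff.2 (measure_singleton a))] with z h1 h2
    exact ⟨h1, h2⟩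
  have hint : IntegrableOn (fun z => Real.log ‖blaschkeFactor a z‖) E := by
    refine Integrable.mono' (hI.const_mul 2)
      (measurable_blaschkeFactor a).norm.log.aestronglyMeasurable ?_
    filter_upwards [hae] with z hz
    have hz1 := mem_ball_zero_iff.1 (hE hz.1)
    have h1 := neg_log_norm_blaschkeFactor_le ha hz1 hz.2 one_pos
    rw [Real.log_one] at h1
    rw [Real.norm_eq_abs, abs_of_nonpos (Real.log_nonpos (norm_nonneg _)
      (norm_blaschkeFactor_lt_one ha hz1).le)]
    linarith
  refine ⟨hint, ?_⟩
  -- With this `k` the term `2 / k * 4π` equals `|E|` and cancels the `-1` in `log k - 1`.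
  set k := 8 * Real.pi / volume.real E with hkdef
  have hk : 0 < k := by positivity
  have hc : IntegrableOn (fun _ : ℂ => Real.log k - 1) E := integrableOn_const hfin
  rw [← integral_neg]
  calc ∫ z in E, -Real.log ‖blaschkeFactor a z‖
      ≤ ∫ z in E, (2 / k * ‖z - a‖⁻¹ + (Real.log k - 1)) := by
        refine integral_mono_ae hint.neg ((hI.const_mul _).add hc) ?_
        filter_upwards [hae] with z hz
        exact neg_log_norm_blaschkeFactor_le ha (mem_ball_zero_iff.1 (hE hz.1)) hz.2 hk
    _ = 2 / k * (∫ z in E, ‖z - a‖⁻¹) + volume.real E * (Real.log k - 1) := by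
        rw [integral_add (hI.const_mul _) hc, integral_const_mul, setIntegral_const, smul_eq_mul]
    _ ≤ 2 / k * (4 * Real.pi) + volume.real E * (Real.log k - 1) := by gcongr
    _ = volume.real E * Real.log k := by
        rw [hkdef]
        field_simp
        ring

/-- Since `|E| ≤ π r²`, the ratio is at least `32 > e`. This lets the zero-free case, which has no
logarithmic factor, be absorbed into the general bound. -/
theorem one_le_log_ratio {E : Set ℂ} {r : ℝ} (hr : 0 < r) (hE : E ⊆ ball 0 r)
    (hEp : 0 < volume.real E) : 1 ≤ Real.log (32 * Real.pi * r ^ 2 / volume.real E) := by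
  have hpi := Real.pi_pos
  have h1 := measureReal_le_of_subset_ball hr hE
  rw [Real.le_log_iff_exp_le (by positivity), le_div_iff₀ hEp]
  have := Real.exp_one_lt_d9
  nlinarith

/-! ### The mean of `log ‖f‖` over a set against one value -/

/-- The estimate for zero-free functions. -/
theorem integral_log_norm_of_ne_zero {f : ℂ → ℂ} {r : ℝ} (hr1 : r < 1)
    (hf : DifferentiableOn ℂ f (ball 0 1)) (hb : ∀ z ∈ ball (0 : ℂ) 1, ‖f z‖ ≤ 1)
    (hne : ∀ z ∈ closedBall (0 : ℂ) ((1 + r) / 2), f z ≠ 0) {z₀ : ℂ} (hz₀ : z₀ ∈ ball (0 : ℂ) r)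
    {E : Set ℂ} (hE : E ⊆ ball 0 r) (hEm : NullMeasurableSet E) :
    IntegrableOn (fun z => Real.log ‖f z‖) E ∧
      -∫ z in E, Real.log ‖f z‖
        ≤ 16 / (1 - r) ^ 2 * volume.real E * -Real.log ‖f z₀‖ := by
  have hr : 0 < r := pos_of_mem_ball hz₀
  have hfin := volume_ne_top_of_subset_ball hE
  have hsub : closedBall (0 : ℂ) ((1 + r) / 2) ⊆ ball 0 1 := closedBall_subset_ball (by linarith)
  have hharm : HarmonicOnNhd (fun z => -Real.log ‖f z‖) (closedBall 0 ((1 + r) / 2)) := fun z hz =>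
    (AnalyticAt.harmonicAt_log_norm
      (hf.analyticAt (isOpen_ball.mem_nhds (hsub hz))) (hne z hz)).neg
  have hpos : ∀ z ∈ closedBall (0 : ℂ) ((1 + r) / 2), 0 ≤ -Real.log ‖f z‖ := fun z hz =>
    neg_nonneg.2 (Real.log_nonpos (norm_nonneg _) (hb z (hsub hz)))
  have hsub' : closedBall (0 : ℂ) r ⊆ closedBall 0 ((1 + r) / 2) :=
    closedBall_subset_closedBall (by linarith)
  have hint : IntegrableOn (fun z => -Real.log ‖f z‖) E := by
    refine (ContinuousOn.integrableOn_compact (isCompact_closedBall (0 : ℂ) r) fun z hz =>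
      (hharm z (hsub' hz)).1.continuousAt.continuousWithinAt).mono_set
      (hE.trans ball_subset_closedBall)
  have hint' : IntegrableOn (fun z => Real.log ‖f z‖) E := by simpa using hint.neg
  refine ⟨hint', ?_⟩
  -- The Harnack radius lies midway between `r` and `1`, so the quotient is `(1 + 3r) / (1 - r) ≤ 4
  -- / (1 - r)`.
  have hK : (((1 + r) / 2 + r) / ((1 + r) / 2 - r)) ^ 2 ≤ 16 / (1 - r) ^ 2 := by
    have h1 : 0 < 1 - r := by linarith
    have h2 : ((1 + r) / 2 + r) / ((1 + r) / 2 - r) ≤ 4 / (1 - r) := by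
      rw [div_le_div_iff₀ (by linarith) h1]
      nlinarith
    have h3 : 0 ≤ ((1 + r) / 2 + r) / ((1 + r) / 2 - r) :=
      div_nonneg (by linarith) (by linarith)
    calc _ ≤ (4 / (1 - r)) ^ 2 := by gcongr
      _ = _ := by rw [div_pow]; norm_num
  rw [← integral_neg]
  calc ∫ z in E, -Real.log ‖f z‖
      ≤ ∫ z in E, 16 / (1 - r) ^ 2 * -Real.log ‖f z₀‖ := by
        refine integral_mono_ae hint (integrableOn_const hfin) ?_
        filter_upwards [ae_restrict_mem₀ hEm] with z hz
        refine (hharm.harnack (by linarith) hpos (hE hz) hz₀).trans ?_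
        exact mul_le_mul_of_nonneg_right hK (hpos _ (hsub' (ball_subset_closedBall hz₀)))
    _ = _ := by rw [setIntegral_const, smul_eq_mul]; ring

/-- Lower bound for the mean of `log ‖f‖` over a set in terms of one value of `f`. -/
theorem integral_log_norm_unitDisc {r : ℝ} (hr2 : 1 / 2 ≤ r) (hr1 : r < 1) {z₀ : ℂ}
    (hz₀ : z₀ ∈ ball (0 : ℂ) r) {E : Set ℂ} (hE : E ⊆ ball 0 r) (hEm : NullMeasurableSet E)
    (hEp : 0 < volume.real E) {f : ℂ → ℂ} (hf : DifferentiableOn ℂ f (ball 0 1))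
    (hb : ∀ z ∈ ball (0 : ℂ) 1, ‖f z‖ ≤ 1) (hf₀ : f z₀ ≠ 0) :
    IntegrableOn (fun z => Real.log ‖f z‖) E ∧ (∀ᵐ z ∂(volume.restrict E), f z ≠ 0) ∧
      -∫ z in E, Real.log ‖f z‖
        ≤ 16 / (1 - r) ^ 2 * Real.log (32 * Real.pi * r ^ 2 / volume.real E) * volume.real E *
          -Real.log ‖f z₀‖ := by
  have hr : 0 < r := by linarith
  have hpi := Real.pi_pos
  have hδ : 0 < 1 - r := by linarith
  have hE1 : E ⊆ ball 0 1 := hE.trans (ball_subset_ball hr1.le)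
  have hz₀1 : z₀ ∈ ball (0 : ℂ) 1 := ball_subset_ball hr1.le hz₀
  have hz₀r := mem_ball_zero_iff.1 hz₀
  set Λ := Real.log (32 * Real.pi * r ^ 2 / volume.real E) with hΛ
  have hΛ1 : 1 ≤ Λ := one_le_log_ratio hr hE hEp
  set ε := (1 - r) ^ 2 / 16 with hε
  have hεpos : 0 < ε := by positivity
  -- Each zero divided out lowers `-log ‖f z₀‖` by at least `ε`, so the induction runs on the number
  -- of such steps that fit; the zeros need not be counted. For `n = 0` the hypothesis contradicts
  -- `‖f z₀‖ ≤ 1`.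
  obtain ⟨n, hn⟩ := exists_nat_gt (-Real.log ‖f z₀‖ / ε)
  rw [div_lt_iff₀ hεpos] at hn
  induction n generalizing f with
  | zero =>
    rw [Nat.cast_zero, zero_mul] at hn
    linarith [Real.log_nonpos (norm_nonneg _) (hb z₀ hz₀1)]
  | succ n ih =>
    by_cases hz : ∃ a ∈ closedBall (0 : ℂ) ((1 + r) / 2), f a = 0
    · obtain ⟨a, has, hfa⟩ := hz
      rw [mem_closedBall_zero_iff] at has
      have ha : ‖a‖ < 1 := by linarith
      have hz₀a : z₀ ≠ a := by rintro rfl; exact hf₀ hfa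
      obtain ⟨g, hg, hgb, hfg⟩ := exists_eq_blaschkeFactor_mul hf hb ha hfa
      have hg₀ : g z₀ ≠ 0 := fun h => hf₀ (by rw [hfg z₀ hz₀1, h, mul_zero])
      have hB₀ := blaschkeFactor_ne_zero ha (mem_ball_zero_iff.1 hz₀1) hz₀a
      have hlog : Real.log ‖f z₀‖ = Real.log ‖blaschkeFactor a z₀‖ + Real.log ‖g z₀‖ := by
        rw [hfg z₀ hz₀1, norm_mul,
          Real.log_mul (norm_ne_zero_iff.2 hB₀) (norm_ne_zero_iff.2 hg₀)]
      -- Here `1 - ‖a‖ ≥ (1 - r) / 2` and `1 - ‖z₀‖ ≥ 1 - r`, whence the 16 in `ε`.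
      have hlow : ε ≤ -Real.log ‖blaschkeFactor a z₀‖ := by
        refine le_trans ?_
          (le_neg_log_norm_blaschkeFactor ha (mem_ball_zero_iff.1 hz₀1) hz₀a)
        rw [hε]
        nlinarith
      have hgl := Real.log_nonpos (norm_nonneg _) (hgb z₀ hz₀1)
      obtain ⟨hgI, hgne, hgle⟩ := ih hg hgb hg₀ (by push_cast at hn; linarith)
      obtain ⟨hBI, hBle⟩ := integral_log_norm_blaschkeFactor ha hE1 hEm hEp
      have hae : ∀ᵐ z ∂(volume.restrict E), f z ≠ 0 ∧
          Real.log ‖f z‖ = Real.log ‖blaschkeFactor a z‖ + Real.log ‖g z‖ := by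
        filter_upwards [ae_restrict_mem₀ hEm, hgne,
          ae_restrict_of_ae (compl_mem_ae_iff.2 (measure_singleton a))] with z h1 h2 h3
        have hB := blaschkeFactor_ne_zero ha (mem_ball_zero_iff.1 (hE1 h1)) h3
        rw [hfg z (hE1 h1), norm_mul,
          Real.log_mul (norm_ne_zero_iff.2 hB) (norm_ne_zero_iff.2 h2)]
        exact ⟨mul_ne_zero hB h2, rfl⟩
      have haeq := hae.mono fun z h => h.2
      refine ⟨(hBI.add hgI).congr (haeq.mono fun z h => h.symm), hae.mono fun z h => h.1, ?_⟩
      rw [integral_congr_ae haeq, integral_add hBI hgI, hlog]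
      -- The assumption `r ≥ 1/2` enters here: it makes the ratio scale-invariant at the cost of a
      -- factor 4.
      have h8 : Real.log (8 * Real.pi / volume.real E) ≤ Λ := by
        apply Real.log_le_log (by positivity)
        have hr4 : 1 / 4 ≤ r ^ 2 := by nlinarith
        have : 8 * Real.pi ≤ 32 * Real.pi * r ^ 2 := by nlinarith
        gcongr
      have h1 : 1 ≤ 16 / (1 - r) ^ 2 * -Real.log ‖blaschkeFactor a z₀‖ := by
        calc (1 : ℝ) = 16 / (1 - r) ^ 2 * ε := by rw [hε]; field_simp
          _ ≤ _ := by gcongr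
      have h2 : volume.real E * Real.log (8 * Real.pi / volume.real E) ≤
          volume.real E * Λ * (16 / (1 - r) ^ 2 * -Real.log ‖blaschkeFactor a z₀‖) := by
        calc _ ≤ volume.real E * Λ * 1 := by rw [mul_one]; gcongr
          _ ≤ _ := by gcongr
      linarith
    · push Not at hz
      obtain ⟨hI, hle⟩ := integral_log_norm_of_ne_zero hr1 hf hb hz hz₀ hE hEm
      refine ⟨hI, ?_, hle.trans ?_⟩
      · filter_upwards [ae_restrict_mem₀ hEm] with z h1
        refine hz z (mem_closedBall_zero_iff.2 ?_)
        linarith [mem_ball_zero_iff.1 (hE h1)]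
      · have hp : 0 ≤ -Real.log ‖f z₀‖ :=
          neg_nonneg.2 (Real.log_nonpos (norm_nonneg _) (hb z₀ hz₀1))
        apply mul_le_mul_of_nonneg_right _ hp
        apply mul_le_mul_of_nonneg_right _ hEp.le
        exact le_mul_of_one_le_right (by positivity) hΛ1

/-- Lower bound for the mean of `log ‖φ‖` over a set in terms of one value of `φ`, on a disc of
arbitrary radius. -/
theorem le_integral_log_norm {r R M : ℝ} (hr : 0 < r) (hr2 : R / 2 ≤ r) (hrR : r < R) {z₀ : ℂ}
    (hz₀ : z₀ ∈ ball (0 : ℂ) r) {E : Set ℂ} (hE : E ⊆ ball 0 r) (hEm : NullMeasurableSet E)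
    (hEp : 0 < volume.real E) {φ : ℂ → ℂ} (hφ : DifferentiableOn ℂ φ (ball 0 R))
    (hM : ∀ z ∈ ball (0 : ℂ) R, ‖φ z‖ ≤ M) (hφ₀ : 1 ≤ ‖φ z₀‖) :
    IntegrableOn (fun z => Real.log ‖φ z‖) E ∧ (∀ᵐ z ∂(volume.restrict E), φ z ≠ 0) ∧
      volume.real E * (Real.log M - 16 * (R / (R - r)) ^ 2 *
          Real.log (32 * Real.pi * r ^ 2 / volume.real E) * Real.log M)
        ≤ ∫ z in E, Real.log ‖φ z‖ := by
  have hR : 0 < R := hr.trans hrR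
  have hz₀R : z₀ ∈ ball (0 : ℂ) R := ball_subset_ball hrR.le hz₀
  have hM0 : 0 < M := by linarith [hM z₀ hz₀R]
  have hMC : (M : ℂ) ≠ 0 := by exact_mod_cast hM0.ne'
  have hpi := Real.pi_pos
  -- Dilation by `R` reduces to the unit disc; areas scale by `R ^ 2`, which leaves `r² / |E|`
  -- unchanged.
  set e : ℂ ≃ᵐ ℂ := MeasurableEquiv.smul₀ R hR.ne' with he
  have hee : ∀ z, e z = (R : ℂ) * z := fun z => Complex.real_smul
  have hen : ∀ z, ‖e z‖ = R * ‖z‖ := fun z => by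
    rw [hee, norm_mul, Complex.norm_real, Real.norm_of_nonneg hR.le]
  have hball : ∀ (t : ℝ) (z : ℂ), z ∈ ball (0 : ℂ) (t / R) → e z ∈ ball (0 : ℂ) t := by
    intro t z hz
    rw [mem_ball_zero_iff] at hz ⊢
    rwa [hen, mul_comm, ← lt_div_iff₀ hR]
  have hball' : ∀ (t : ℝ) (z : ℂ), e z ∈ ball (0 : ℂ) t → z ∈ ball (0 : ℂ) (t / R) := by
    intro t z hz
    rw [mem_ball_zero_iff] at hz ⊢
    rwa [hen, mul_comm, ← lt_div_iff₀ hR] at hz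
  have hmapvol : (volume : Measure ℂ).map e = ENNReal.ofReal (R ^ 2)⁻¹ • volume := by
    have := Measure.map_addHaar_smul (volume : Measure ℂ) hR.ne'
    rw [Complex.finrank_real_complex, abs_of_pos (by positivity)] at this
    exact this
  set F : Set ℂ := e ⁻¹' E with hF
  have hmap : (volume.restrict F).map e = ENNReal.ofReal (R ^ 2)⁻¹ • volume.restrict E := by
    rw [hF, ← e.restrict_map, hmapvol, Measure.restrict_smul]
  have hvolF : volume.real F = (R ^ 2)⁻¹ * volume.real E := by
    rw [measureReal_def, hF, ← e.map_apply, hmapvol, Measure.smul_apply, smul_eq_mul,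
      ENNReal.toReal_mul, ENNReal.toReal_ofReal (by positivity), measureReal_def]
  have hFm : NullMeasurableSet F := by
    refine hEm.preimage ⟨e.measurable, ?_⟩
    rw [hmapvol]
    exact Measure.smul_absolutelyContinuous
  have hc0 : ENNReal.ofReal (R ^ 2)⁻¹ ≠ 0 := by
    rw [ne_eq, ENNReal.ofReal_eq_zero, not_le]
    positivity
  set f : ℂ → ℂ := fun w => φ (e w) / M with hf
  have hes : e (e.symm z₀) = z₀ := e.apply_symm_apply z₀
  have hmaps : ∀ w ∈ ball (0 : ℂ) 1, e w ∈ ball (0 : ℂ) R := fun w hw =>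
    hball R w (by rwa [div_self hR.ne'])
  have hfd : DifferentiableOn ℂ f (ball 0 1) := by
    refine DifferentiableOn.div_const (hφ.comp (t := ball 0 R) ?_ hmaps) _
    have : (e : ℂ → ℂ) = fun z => (R : ℂ) * z := funext hee
    rw [this]
    fun_prop
  have hfn : ∀ w, ‖f w‖ = ‖φ (e w)‖ / M := fun w => by
    rw [hf, norm_div, Complex.norm_real, Real.norm_of_nonneg hM0.le]
  obtain ⟨hI, hne, hle⟩ := integral_log_norm_unitDisc (r := r / R) (z₀ := e.symm z₀) (E := F)
    (f := f) (by rw [le_div_iff₀ hR]; linarith) (by rwa [div_lt_one hR])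
    (hball' r _ (by rwa [hes])) (fun z hz => hball' r z (hE hz)) hFm
    (by rw [hvolF]; positivity) hfd
    (fun w hw => by rw [hfn, div_le_one hM0]; exact hM _ (hmaps w hw))
    (by
      rw [hf]
      simp only [hes]
      refine div_ne_zero (norm_pos_iff.1 (by linarith)) hMC)
  have hne' : ∀ᵐ z ∂(volume.restrict E), φ z ≠ 0 := by
    have h1 : ∀ᵐ w ∂(volume.restrict F), φ (e w) ≠ 0 := by
      filter_upwards [hne] with w hw h
      exact hw (by simp [hf, h])
    have h2 := (e.measurableEmbedding.ae_map_iff (p := fun z => φ z ≠ 0)).2 h1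
    rw [hmap] at h2
    rwa [Measure.ae_ennreal_smul_measure_eq hc0] at h2
  have hlog : ∀ᵐ z ∂(volume.restrict E),
      Real.log (‖φ z‖ / M) = Real.log ‖φ z‖ - Real.log M := by
    filter_upwards [hne'] with z hz
    exact Real.log_div (norm_ne_zero_iff.2 hz) hM0.ne'
  simp only [hfn] at hI hle
  have hfin := volume_ne_top_of_subset_ball hE
  have hI2 : IntegrableOn (fun z => Real.log (‖φ z‖ / M)) E := by
    have h1 : Integrable (fun z => Real.log (‖φ z‖ / M)) ((volume.restrict F).map e) :=
      (integrable_map_equiv e _).2 hI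
    rw [hmap] at h1
    exact (integrable_smul_measure hc0 ENNReal.ofReal_ne_top).1 h1
  have hcM : IntegrableOn (fun _ : ℂ => Real.log M) E := integrableOn_const hfin
  have hI3 : IntegrableOn (fun z => Real.log ‖φ z‖) E := by
    refine (hI2.add hcM).congr (hlog.mono fun z hz => ?_)
    rw [Pi.add_apply, hz, sub_add_cancel]
  refine ⟨hI3, hne', ?_⟩
  have hint : ∫ w in F, Real.log (‖φ (e w)‖ / M)
      = (R ^ 2)⁻¹ * ((∫ z in E, Real.log ‖φ z‖) - volume.real E * Real.log M) := by
    rw [← integral_map_equiv e (fun z => Real.log (‖φ z‖ / M)), hmap, integral_smul_measure,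
      integral_congr_ae hlog, integral_sub hI3 hcM, setIntegral_const,
      ENNReal.toReal_ofReal (by positivity), smul_eq_mul, smul_eq_mul]
  have hratio : 32 * Real.pi * (r / R) ^ 2 / ((R ^ 2)⁻¹ * volume.real E)
      = 32 * Real.pi * r ^ 2 / volume.real E := by
    field_simp
  have hη : 16 / (1 - r / R) ^ 2 = 16 * (R / (R - r)) ^ 2 := by
    have : R - r ≠ 0 := by linarith
    field_simp
  rw [hint, hvolF, hratio, hη, hes] at hle
  have hΛ := one_le_log_ratio hr hE hEp
  set Λ := Real.log (32 * Real.pi * r ^ 2 / volume.real E) with hΛdef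
  -- This is where `‖φ z₀‖ ≥ 1` gives the factor `log M`.
  have hL : -Real.log (‖φ z₀‖ / M) ≤ Real.log M := by
    rw [Real.log_div (by linarith) hM0.ne']
    linarith [Real.log_nonneg hφ₀]
  have h3 : -((R ^ 2)⁻¹ * ((∫ z in E, Real.log ‖φ z‖) - volume.real E * Real.log M)) ≤
      16 * (R / (R - r)) ^ 2 * Λ * ((R ^ 2)⁻¹ * volume.real E) * Real.log M :=
    hle.trans (mul_le_mul_of_nonneg_left hL (by positivity))
  have h4 : 0 < (R ^ 2)⁻¹ := by positivity
  refine le_of_mul_le_mul_left ?_ h4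
  linarith

/-! ### From logarithmic means to `Lᵖ` norms -/

/-- **Jensen's inequality** for the geometric mean: a lower bound for the `Lᵖ` norm. -/
theorem le_eLpNorm_of_le_integral_log {E : Set ℂ} {φ : ℂ → ℂ} {p ℓ M : ℝ} (hp : 0 < p)
    (hE : volume E ≠ ⊤) (hm : AEStronglyMeasurable φ (volume.restrict E))
    (hb : ∀ᵐ z ∂(volume.restrict E), ‖φ z‖ ≤ M)
    (hI : IntegrableOn (fun z => Real.log ‖φ z‖) E) (hne : ∀ᵐ z ∂(volume.restrict E), φ z ≠ 0)
    (hℓ : volume.real E * ℓ ≤ ∫ z in E, Real.log ‖φ z‖) :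
    ENNReal.ofReal (volume.real E ^ (1 / p) * Real.exp ℓ) ≤
      eLpNorm φ (ENNReal.ofReal p) (volume.restrict E) := by
  have : IsFiniteMeasure (volume.restrict E) := isFiniteMeasure_restrict.2 hE
  have hmem : MemLp φ (ENNReal.ofReal p) (volume.restrict E) := MemLp.of_bound hm M hb
  have hp0 : ENNReal.ofReal p ≠ 0 := by simpa using hp
  have hmp := hmem.integrable_norm_rpow hp0 ENNReal.ofReal_ne_top
  rw [hmem.eLpNorm_eq_integral_rpow_norm hp0 ENNReal.ofReal_ne_top]
  rw [ENNReal.toReal_ofReal hp.le] at hmp ⊢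
  refine ENNReal.ofReal_le_ofReal ?_
  have hcI : ∀ c : ℝ, IntegrableOn (fun _ : ℂ => c) E := fun c => integrableOn_const hE
  have hsub : IntegrableOn (fun z => p * (Real.log ‖φ z‖ - ℓ)) E := (hI.sub (hcI ℓ)).const_mul p
  have hlin : IntegrableOn (fun z => Real.exp (p * ℓ) * (1 + p * (Real.log ‖φ z‖ - ℓ))) E :=
    ((hcI 1).add hsub).const_mul _
  -- Jensen by the tangent line: integrate `exp x ≥ exp (p ℓ) * (1 + (x - p ℓ))` at `x = p log ‖φ
  -- z‖`.
  have hkey : volume.real E * Real.exp (p * ℓ) ≤ ∫ z in E, ‖φ z‖ ^ p := by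
    calc volume.real E * Real.exp (p * ℓ)
        ≤ Real.exp (p * ℓ) * (volume.real E * 1 +
            p * ((∫ z in E, Real.log ‖φ z‖) - volume.real E * ℓ)) := by
          have h1 : 0 ≤ p * ((∫ z in E, Real.log ‖φ z‖) - volume.real E * ℓ) :=
            mul_nonneg hp.le (by linarith)
          nlinarith [Real.exp_pos (p * ℓ)]
      _ = ∫ z in E, Real.exp (p * ℓ) * (1 + p * (Real.log ‖φ z‖ - ℓ)) := by
          rw [integral_const_mul, integral_add (hcI 1) hsub,
            integral_const_mul, integral_sub hI (hcI ℓ), setIntegral_const, setIntegral_const,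
            smul_eq_mul, smul_eq_mul]
      _ ≤ ∫ z in E, ‖φ z‖ ^ p := by
          refine integral_mono_ae hlin hmp ?_
          filter_upwards [hne] with z hz
          have h1 := Real.add_one_le_exp (p * (Real.log ‖φ z‖ - ℓ))
          calc Real.exp (p * ℓ) * (1 + p * (Real.log ‖φ z‖ - ℓ))
              ≤ Real.exp (p * ℓ) * Real.exp (p * (Real.log ‖φ z‖ - ℓ)) := by
                gcongr
                linarith
            _ = ‖φ z‖ ^ p := by
                rw [← Real.exp_add, Real.rpow_def_of_pos (norm_pos_iff.2 hz)]
                congr 1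
                ring
  calc volume.real E ^ (1 / p) * Real.exp ℓ
      = (volume.real E * Real.exp (p * ℓ)) ^ p⁻¹ := by
        rw [Real.mul_rpow measureReal_nonneg (Real.exp_pos _).le, ← Real.exp_mul, one_div]
        congr 2
        field_simp
    _ ≤ _ := by gcongr

theorem eLpNorm_le_of_bound_ball {φ : ℂ → ℂ} {p r M : ℝ} (hp : 0 < p) (hr : 0 < r)
    (hM : ∀ z ∈ ball (0 : ℂ) r, ‖φ z‖ ≤ M) :
    eLpNorm φ (ENNReal.ofReal p) (volume.restrict (ball 0 r)) ≤
      ENNReal.ofReal ((Real.pi * r ^ 2) ^ (1 / p) * M) := by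
  have hpi := Real.pi_pos
  refine (eLpNorm_le_of_ae_bound (C := M)
    ((ae_restrict_mem measurableSet_ball).mono fun z hz => hM z hz)).trans_eq ?_
  have hv : volume (ball (0 : ℂ) r) = ENNReal.ofReal (Real.pi * r ^ 2) := by
    rw [Complex.volume_ball, mul_comm, ENNReal.ofReal_mul hpi.le, ENNReal.ofReal_pow hr.le]
    congr 1
    exact (ENNReal.ofReal_coe_nnreal).symm
  rw [Measure.restrict_apply_univ, hv, ENNReal.toReal_ofReal hp.le,
    ENNReal.ofReal_rpow_of_pos (by positivity), ENNReal.ofReal_mul (by positivity), one_div]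

/-- **Remez-type inequality** in `Lᵖ` on a disc, in the case of comparable radii. -/
theorem eLpNorm_ball_le_of_comparable {r R M p : ℝ} (hr : 0 < r) (hr2 : R / 2 ≤ r) (hrR : r < R)
    (hp : 0 < p) {z₀ : ℂ} (hz₀ : z₀ ∈ ball (0 : ℂ) r) {E : Set ℂ} (hE : E ⊆ ball 0 r)
    (hEm : NullMeasurableSet E) (hEp : 0 < volume E) {φ : ℂ → ℂ}
    (hφ : DifferentiableOn ℂ φ (ball 0 R)) (hM : ∀ z ∈ ball (0 : ℂ) R, ‖φ z‖ ≤ M)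
    (hφ₀ : 1 ≤ ‖φ z₀‖) :
    eLpNorm φ (ENNReal.ofReal p) (volume.restrict (ball 0 r)) ≤
      ENNReal.ofReal ((32 * Real.pi * r ^ 2 / (volume E).toReal) ^
          (16 * (R / (R - r)) ^ 2 * Real.log M + 1 / p)) *
        eLpNorm φ (ENNReal.ofReal p) (volume.restrict E) := by
  have hpi := Real.pi_pos
  have hfin := volume_ne_top_of_subset_ball hE
  have hV : 0 < volume.real E := ENNReal.toReal_pos hEp.ne' hfin
  have hEB : E ⊆ ball 0 R := hE.trans (ball_subset_ball hrR.le)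
  have hM1 : 1 ≤ M := hφ₀.trans (hM z₀ (ball_subset_ball hrR.le hz₀))
  have hM0 : 0 < M := by linarith
  obtain ⟨hI, hne, hle⟩ := le_integral_log_norm hr hr2 hrR hz₀ hE hEm hV hφ hM hφ₀
  have hm : AEStronglyMeasurable φ (volume.restrict E) :=
    (hφ.continuousOn.aestronglyMeasurable measurableSet_ball).mono_set hEB
  have hlow := le_eLpNorm_of_le_integral_log hp hfin hm
    ((ae_restrict_mem₀ hEm).mono fun z hz => hM z (hEB hz)) hI hne hle
  refine (eLpNorm_le_of_bound_ball hp hr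
    fun z hz => hM z (ball_subset_ball hrR.le hz)).trans ?_
  refine le_trans ?_ (mul_le_mul_right hlow _)
  rw [← measureReal_def]
  set V := volume.real E
  set Q := 32 * Real.pi * r ^ 2 / V with hQ
  set L := Real.log M with hL
  set η := 16 * (R / (R - r)) ^ 2
  have hQ0 : 0 < Q := by positivity
  rw [← ENNReal.ofReal_mul (by positivity)]
  refine ENNReal.ofReal_le_ofReal ?_
  -- The power of `Q` exactly offsets the loss `η log Q · L` in the logarithmic mean, leaving `M`.
  have h1 : Q ^ (η * L) * Real.exp (L - η * Real.log Q * L) = M := by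
    rw [Real.rpow_def_of_pos hQ0, ← Real.exp_add, ← Real.exp_log hM0]
    congr 1
    ring
  have h2 : Q ^ (1 / p) * V ^ (1 / p) = (32 * Real.pi * r ^ 2) ^ (1 / p) := by
    rw [← Real.mul_rpow hQ0.le hV.le, hQ, div_mul_cancel₀ _ hV.ne']
  calc (Real.pi * r ^ 2) ^ (1 / p) * M ≤ (32 * Real.pi * r ^ 2) ^ (1 / p) * M := by
        gcongr
        nlinarith
    _ = Q ^ (1 / p) * V ^ (1 / p) * (Q ^ (η * L) * Real.exp (L - η * Real.log Q * L)) := by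
        rw [h1, h2]
    _ = _ := by rw [Real.rpow_add hQ0]; ring

/-! ### Choice of the radius and the constants -/

theorem mainTheorem4 :
    ∃ c C : ℝ, 0 < c ∧ 0 < C ∧
      ∀ r ρ : ℝ, 0 < r → r < ρ →
        ∃ η : ℝ, 0 < η ∧
          η ≤ C * (ρ ^ 4 / (ρ - r) ^ 4) * (1 + Real.log (ρ / (ρ - r))) ∧
          (ρ / 2 ≤ r → η ≤ C * (ρ ^ 4 / (ρ - r) ^ 4) * Real.log (ρ / (ρ - r))) ∧
          ∀ (φ : ℂ → ℂ) (E : Set ℂ) (z₀ : ℂ) (M p : ℝ),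
            AnalyticOnNhd ℂ φ (Metric.ball 0 ρ) →
            MeasureTheory.NullMeasurableSet E MeasureTheory.volume →
            E ⊆ Metric.ball 0 r →
            0 < MeasureTheory.volume E →
            z₀ ∈ Metric.ball 0 r →
            1 ≤ ‖φ z₀‖ →
            (∀ z ∈ Metric.ball (0 : ℂ) ρ, ‖φ z‖ ≤ M) →
            1 ≤ p →
            MeasureTheory.eLpNorm φ (ENNReal.ofReal p)
                (MeasureTheory.volume.restrict (Metric.ball 0 r)) ≤
              ENNReal.ofReal
                  ((c * r ^ 2 / (MeasureTheory.volume E).toReal) ^ (η * Real.log M + 1 / p)) *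
                MeasureTheory.eLpNorm φ (ENNReal.ofReal p)
                  (MeasureTheory.volume.restrict E) := by
  refine ⟨32 * Real.pi, 128, by positivity, by norm_num, fun r ρ hr hrρ => ?_⟩
  have hd : 0 < ρ - r := by linarith
  have hK : 1 ≤ ρ / (ρ - r) := by rw [le_div_iff₀ hd]; linarith
  have hK4 : (ρ / (ρ - r)) ^ 2 ≤ ρ ^ 4 / (ρ - r) ^ 4 := by
    rw [← div_pow]
    exact pow_le_pow_right₀ hK (by norm_num)
  have hK1 : 1 ≤ ρ ^ 4 / (ρ - r) ^ 4 := (one_le_pow₀ hK).trans hK4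
  have hlog := Real.log_nonneg hK
  -- The estimate needs comparable radii, so for `ρ > 2r` only the disc of radius `2r` is used;
  -- there `R / (R - r) = 2` and `η = 64`.
  set R := min ρ (2 * r) with hR
  have hrR : r < R := lt_min hrρ (by linarith)
  have hRr : 0 < R - r := by linarith
  have hR2 : R / 2 ≤ r := by linarith [min_le_right ρ (2 * r)]
  have hRρ : R ≤ ρ := min_le_left _ _
  refine ⟨16 * (R / (R - r)) ^ 2, ?_, ?_, ?_, ?_⟩
  · have : 0 < R := by linarith
    positivity
  · have h1 : 16 * (R / (R - r)) ^ 2 ≤ 128 * (ρ ^ 4 / (ρ - r) ^ 4) := by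
      rcases min_choice ρ (2 * r) with h | h <;> rw [hR, h]
      · linarith
      · have : 2 * r / (2 * r - r) = 2 := by
          rw [div_eq_iff (by linarith)]
          ring
        rw [this]
        linarith
    exact h1.trans (le_mul_of_one_le_right (by positivity) (by linarith))
  · intro h2
    have hRe : R = ρ := min_eq_left (by linarith)
    -- For `r ≥ ρ / 2` the ratio is at least 2, so the logarithm alone is bounded below and the
    -- summand 1 can be dropped.
    have hl2 : 1 / 2 ≤ Real.log (ρ / (ρ - r)) := by
      have : Real.log 2 ≤ Real.log (ρ / (ρ - r)) := by
        apply Real.log_le_log (by norm_num)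
        rw [le_div_iff₀ hd]
        linarith
      linarith [Real.log_two_gt_d9]
    rw [hRe]
    calc 16 * (ρ / (ρ - r)) ^ 2 ≤ 128 * (ρ ^ 4 / (ρ - r) ^ 4) * (1 / 2) := by linarith
      _ ≤ _ := by gcongr
  · intro φ E z₀ M p hφ hEm hE hEp hz₀ hφ₀ hM hp
    have hsub : ball (0 : ℂ) R ⊆ ball 0 ρ := ball_subset_ball hRρ
    exact eLpNorm_ball_le_of_comparable hr hR2 hrR (by linarith) hz₀ hE hEm hEp
      (hφ.differentiableOn.mono hsub) (fun z hz => hM z (hsub hz)) hφ₀
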